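/- **Setting.** Let $G$ be a connected, locally finite graph (parallel edges and loops are allowed) with vertex set $V$ and edge set $E$, and let $p_e\in(0,1]$ for every $e\in E$. Let $\pi$ be the product measure on $\{\text{on},\text{off}\}^E$ under which each edge $e$ is on with probability $p_e$, independently of the other edges. In *dynamical percolation* $(\omega_t)_{t\ge 0}$ the statuses of the edges evolve independently, the status of $e$ being the stationary continuous-time two-state Markov chain that switches from off to on at rate $p_e$ and from on to off at rate $1-p_e$; in particular $\omega_t$ has law $\pi$ for each $t$. By convention an edge is on at the times at which it switches. Write $\{x\leftrightarrow\infty\}$ for the event that the cluster of on edges containing $x$ is infinite, and $\{x\overset{t}{\leftrightarrow}\infty\}$ for the event that this occurs in $\omega_t$. An edge $e$ is *pivotal* for an event if changing the status of $e$ changes whether or not the event occurs. The influence $I_x(e)$ is the $\pi$-probability that $e$ is pivotal for $\{x\leftrightarrow\infty\}$. **Theorem 1.4.** Suppose that $G$ percolates at a fixed time, that is, $\pi$-almost surely there is an infinite cluster of on edges. Let $x\in V$ and assume that $$\sum_{e\in E} I_x(e)<\infty .$$ Then almost surely the function $f(t):=\mathbf 1_{\{x\overset{t}{\leftrightarrow}\infty\}}$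 is equal, for Lebesgue-almost every $t\in[0,1]$, to a function of bounded variation on $[0,1]$, and there are no exceptional times of nonpercolation: almost surely, for every $t\ge 0$ there is an infinite cluster of on edges in $\omega_t$. Moreover, the second conclusion follows from the first, also without the summability assumption: for $G$ percolating at a fixed time and $x\in V$, if almost surely $f$ is equal almost everywhere on $[0,1]$ to a function of bounded variation on $[0,1]$, then almost surely there is an infinite cluster of on edges in $\omega_t$ for every $t\ge0$. -/

import Mathlib

open MeasureTheory ProbabilityTheory unitInterval
open scoped NNReal ENNReal

noncomputable section

namespace DynPerc

universe u v w

variable {V : Type u} {E : Type v}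

/-! ### Graphs and static percolation

`Graph V E` is Mathlib's type of graphs with vertices in `V` and edges in `E`; parallel edges and
loops are allowed. -/

/-- Every vertex is incident with only finitely many edges. -/
def LocallyFinite (G : Graph V E) : Prop :=
  ∀ v ∈ G.vertexSet, {e | G.Inc e v}.Finite

/-- Any two vertices are joined by a path (and there is at least one vertex). -/
def Connected (G : Graph V E) : Prop :=
  G.vertexSet.Nonempty ∧
    ∀ u ∈ G.vertexSet, ∀ v ∈ G.vertexSet, Relation.ReflTransGen G.Adj u v

/-- A percolation configuration: `true` means open (on), `false` means closed (off). -/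
abbrev Config (G : Graph V E) : Type v := G.edgeSet → Bool

/-- `u` and `v` are the ends of some open edge. -/
def OpenAdj (G : Graph V E) (ω : Config G) (u v : V) : Prop :=
  ∃ e : G.edgeSet, ω e = true ∧ G.IsLink e u v

/-- The open cluster of `x`: all vertices reached from `x` by an open path. -/
def cluster (G : Graph V E) (ω : Config G) (x : V) : Set V :=
  {y | Relation.ReflTransGen (OpenAdj G ω) x y}

/-- The event `x ↔ ∞`: the open cluster of `x` is infinite. -/
def percolatesFrom (G : Graph V E) (x : V) : Set (Config G) :=
  {ω | (cluster G ω x).Infinite}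

/-- The event that there is an infinite open cluster somewhere in the graph. -/
def percolates (G : Graph V E) : Set (Config G) :=
  {ω | ∃ x ∈ G.vertexSet, ω ∈ percolatesFrom G x}

/-- The percolation measure: the edges are independent, and `e` is open with probability `p e`. -/
def percMeasure (G : Graph V E) (p : G.edgeSet → I) : Measure (Config G) :=
  Measure.infinitePi fun e => bernoulliMeasure true false (p e)

open Classical in
/-- The configuration with the status of the edge `e` changed. -/
def flip (G : Graph V E) (e : G.edgeSet) (ω : Config G) : Config G :=
  Function.update ω e (!ω e)

/-- In the configuration `ω`, the edge `e` is pivotal for the event `A`: changing the status of `e`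
changes whether or not `A` occurs. -/
def IsPivotal (G : Graph V E) (A : Set (Config G)) (e : G.edgeSet) (ω : Config G) : Prop :=
  ¬ (flip G e ω ∈ A ↔ ω ∈ A)

/-- The influence of `e` on the event `A`: the probability that `e` is pivotal for `A`. -/
def influence (G : Graph V E) (p : G.edgeSet → I) (A : Set (Config G)) (e : G.edgeSet) : ℝ≥0∞ :=
  percMeasure G p {ω | IsPivotal G A e ω}

/-! ### The two-state Markov chain of a single edge -/

/-- Jump rates: off to on at rate `p`, on to off at rate `1 - p`. -/
def rate (p : ℝ) : Bool → Bool → ℝ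
  | false, true => p
  | false, false => -p
  | true, false => 1 - p
  | true, true => -(1 - p)

/-- The stationary distribution of the chain. -/
def stationary (p : ℝ) : Bool → ℝ
  | true => p
  | false => 1 - p

/-- The probability that the chain goes from `a` to `b` in time `s`. -/
def transition (p s : ℝ) (a b : Bool) : ℝ :=
  Real.exp (-s) * (if a = b then 1 else 0) + (1 - Real.exp (-s)) * stationary p b

theorem transition_zero (p : ℝ) (a b : Bool) :
    transition p 0 a b = if a = b then 1 else 0 := by
  simp [transition]

/-- `transition` solves the Kolmogorov forward equation of the chain with the jump rates `rate`;
with `transition_zero` this identifies it as the transition function of that chain. -/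
theorem hasDerivAt_transition (p s : ℝ) (a b : Bool) :
    HasDerivAt (fun r => transition p r a b) (∑ c, transition p s a c * rate p c b) s := by
  have h : HasDerivAt (fun r : ℝ => Real.exp (-r)) (-Real.exp (-s)) s := by
    simpa using (hasDerivAt_neg s).exp
  have h2 := (h.mul_const (if a = b then (1 : ℝ) else 0)).add
    ((h.const_sub 1).mul_const (stationary p b))
  refine h2.congr_deriv ?_
  cases a <;> cases b <;> simp [transition, stationary, rate] <;> ring

/-- `X` is a stationary continuous-time Markov chain on `{off, on}` with jump rates `rate p`, given
by its finite-dimensional distributions. -/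
def IsStationaryChain {Ω : Type w} [MeasurableSpace Ω] (P : Measure Ω) (p : ℝ)
    (X : ℝ≥0 → Ω → Bool) : Prop :=
  (∀ t, Measurable (X t)) ∧
  ∀ (n : ℕ) (t : ℕ → ℝ≥0) (a : ℕ → Bool), Monotone t →
    P.real {ω | ∀ i ≤ n, X (t i) ω = a i} =
      stationary p (a 0) *
        ∏ i ∈ Finset.range n, transition p ((t (i + 1) : ℝ) - (t i : ℝ)) (a i) (a (i + 1))

/-- A path of the status of one edge is regular if it switches only finitely often in bounded time
(the switching times are the boundary points of the set of on-times), the edge is on at the times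
at which it switches, so that the set of on-times is closed, and there are no isolated on-times.
Equivalently, up to its finitely many switching times in bounded time the path is locally constant,
and the set of on-times is the closure of its interior. -/
def RegularPath (f : ℝ≥0 → Bool) : Prop :=
  (∀ T : ℝ≥0, (frontier {t | f t = true} ∩ Set.Iic T).Finite) ∧
    closure (interior {t | f t = true}) = {t | f t = true}

/-- `η` is a dynamical percolation process on `G` with edge probabilities `p`; `η t ω e` is the
status of `e` at time `t`. The edges evolve independently, each as a stationary two-state
chain, and almost surely all paths are regular. -/
structure IsDynamicalPercolation (G : Graph V E) (p : G.edgeSet → I)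
    {Ω : Type w} [MeasurableSpace Ω] (P : Measure Ω) (η : ℝ≥0 → Ω → Config G) : Prop where
  chain : ∀ e, IsStationaryChain P (p e : ℝ) (fun t ω => η t ω e)
  indep : iIndepFun (fun (e : G.edgeSet) (ω : Ω) (t : ℝ≥0) => η t ω e) P
  regular : ∀ᵐ ω ∂P, ∀ e, RegularPath (fun t => η t ω e)

open Classical in
/-- The function `f(t)` on the time axis that is the indicator of `x ↔ ∞` at time `t`, for a path
`c` of configurations; it is only used for `t ≥ 0`. -/
def percIndicator (G : Graph V E) (x : V) (c : ℝ≥0 → Config G) (t : ℝ) : ℝ :=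
  if c t.toNNReal ∈ percolatesFrom G x then 1 else 0

/-- On `[0,1]`, `f` is equal Lebesgue-almost everywhere to a function of bounded variation. -/
def AEEqBoundedVariation (f : ℝ → ℝ) : Prop :=
  ∃ g : ℝ → ℝ, BoundedVariationOn g (Set.Icc 0 1) ∧
    ∀ᵐ t ∂(volume.restrict (Set.Icc (0 : ℝ) 1)), f t = g t

end DynPerc

end

/-!
Write `A` for the event that the cluster of `x` is infinite and `f(t)` for the indicator of `A` at
time `t`.

**Bounded variation.** For `s ≤ t` the configurations at the two times have independent coordinates
and the same law. Replacing the coordinates of the first by those of the second one at a time, each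
replacement of an edge `e` matters only if its status differs at the two times, which has
probability at most `t - s`, and if `e` is pivotal, which is independent of the status of `e`. Hence
`P(f(s) ≠ f(t)) ≤ (t - s) ∑ I_x(e)` (`measure_not_mem_iff_mem_le`, where the passage to infinitely
many edges is by approximation with cylinder events, and `measure_not_iff_le`). So the expected
`L¹`-norms of the difference quotients of `f` are bounded, and by Fatou's lemma they almost surely
stay bounded along a subsequence of steps. Then the moving averages of `f` have bounded variation
along this subsequence, they converge to `f` almost everywhere, and their limit has bounded
variation on the set where they converge (`aeEqBoundedVariation_of_frequently`). The extension of
`f` from this set to `[0, 1]` is `exists_boundedVariationOn_extension`.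

**No exceptional times.** A finite cluster is certified by finitely many closed edges, and the
on-times of an edge form a closed set, so the set of times at which `x` percolates is closed. If `f`
is almost everywhere equal to a function of bounded variation and does not vanish almost everywhere,
it is therefore equal to `1` throughout some interval. As `x` percolates at a fixed time with
positive probability, for some `L > 0` there is a positive probability that during the time interval
`[0, L)` a finite set of vertices suffices to witness an infinite cluster (`witnessedUntil`; here
the finite set is `{x}`). This event does not change when finitely many edges do, since their ends
can be added to the finite set, so by Kolmogorov's 0-1 law its probability is `1`. By stationarity
it also occurs almost surely for each of the time intervals `[nL, (n+1)L)`, and these cover all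
times (`ae_forall_mem_percolates`).
-/

namespace DynPerc

/-! ### Infinite clusters -/

section Clusters

variable {V E : Type*} {G : Graph V E}

lemma cluster_subset_vertexSet (ω : Config G) {x : V} (hx : x ∈ G.vertexSet) :
    cluster G ω x ⊆ G.vertexSet := by
  intro y hy
  induction hy with
  | refl => exact hx
  | tail _ h _ =>
    obtain ⟨e, -, he⟩ := h
    exact he.right_mem

lemma OpenAdj.mono {ω ω' : Config G} (h : ∀ e, ω e = true → ω' e = true) {u v : V}
    (huv : OpenAdj G ω u v) : OpenAdj G ω' u v := by
  obtain ⟨e, he, hl⟩ := huv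
  exact ⟨e, h e he, hl⟩

lemma percolatesFrom_mono {ω ω' : Config G} (h : ∀ e, ω e = true → ω' e = true) {x : V}
    (hx : ω ∈ percolatesFrom G x) : ω' ∈ percolatesFrom G x :=
  Set.Infinite.mono (fun _ hy => Relation.ReflTransGen.mono (fun _ _ => OpenAdj.mono h) _ _ hy) hx

/-- A vertex joined to `v` by an open edge percolates whenever `v` does. -/
lemma percolatesFrom_of_openAdj {ω : Config G} {u v : V} (huv : OpenAdj G ω u v)
    (hv : ω ∈ percolatesFrom G v) : ω ∈ percolatesFrom G u :=
  Set.Infinite.mono (fun _ hy => Relation.ReflTransGen.head huv hy) hv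

/-- If the cluster of `x` is finite, this is certified by the finitely many closed edges at its
boundary. -/
lemma exists_finset_of_notMem_percolatesFrom (hfin : LocallyFinite G) {x : V}
    (hx : x ∈ G.vertexSet) {ω : Config G} (hω : ω ∉ percolatesFrom G x) :
    ∃ F : Finset G.edgeSet, (∀ e ∈ F, ω e = false) ∧
      ∀ ω' : Config G, (∀ e ∈ F, ω' e = false) → ω' ∉ percolatesFrom G x := by
  have hC : (cluster G ω x).Finite := Set.not_infinite.1 hω
  have hS : {e : G.edgeSet | ω e = false ∧ ∃ v ∈ cluster G ω x, G.Inc e v}.Finite := by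
    have h1 : (⋃ v ∈ cluster G ω x, {e | G.Inc e v}).Finite :=
      hC.biUnion fun v hv => hfin v (cluster_subset_vertexSet ω hx hv)
    refine Set.Finite.of_finite_image (f := Subtype.val) (h1.subset ?_)
      Subtype.val_injective.injOn
    rintro _ ⟨e, ⟨-, v, hv, hev⟩, rfl⟩
    exact Set.mem_biUnion hv hev
  refine ⟨hS.toFinset, fun e he => ((Set.Finite.mem_toFinset _).1 he).1, fun ω' hω' => ?_⟩
  refine Set.not_infinite.2 (hC.subset fun y hy => ?_)
  induction hy with
  | refl => exact Relation.ReflTransGen.refl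
  | @tail z w _ hzw ih =>
    obtain ⟨e, he, hl⟩ := hzw
    refine Relation.ReflTransGen.tail ih ⟨e, ?_, hl⟩
    by_contra hne
    have : ω' e = false := hω' e ((Set.Finite.mem_toFinset _).2
      ⟨by simpa using hne, z, ih, hl.inc_left⟩)
    simp_all

lemma isClosed_percolatesFrom (hfin : LocallyFinite G) {x : V} (hx : x ∈ G.vertexSet) :
    IsClosed (percolatesFrom G x) := by
  refine ⟨isOpen_iff_mem_nhds.2 fun ω hω => ?_⟩
  obtain ⟨F, hF, hF'⟩ := exists_finset_of_notMem_percolatesFrom hfin hx hω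
  have hopen : IsOpen {ω' : Config G | ∀ e ∈ F, ω' e = false} := by
    have : {ω' : Config G | ∀ e ∈ F, ω' e = false}
        = (F : Set G.edgeSet).pi fun _ => {false} := by
      ext; simp [Set.mem_pi]
    rw [this]
    exact isOpen_set_pi F.finite_toSet fun _ _ => isOpen_discrete _
  exact Filter.mem_of_superset (hopen.mem_nhds hF) hF'

/-- The set of times at which `x` percolates is closed, because the set of on-times of each edge is
closed. -/
lemma isClosed_setOf_mem_percolatesFrom {T : Type*} [TopologicalSpace T] (hfin : LocallyFinite G)
    {x : V} (hx : x ∈ G.vertexSet) {c : T → Config G} (hc : ∀ e, IsClosed {t | c t e = true}) :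
    IsClosed {t | c t ∈ percolatesFrom G x} := by
  refine ⟨isOpen_iff_mem_nhds.2 fun t ht => ?_⟩
  obtain ⟨F, hF, hF'⟩ := exists_finset_of_notMem_percolatesFrom hfin hx ht
  have hopen : IsOpen (⋂ e ∈ F, {t | c t e = true}ᶜ) :=
    isOpen_biInter_finset fun e _ => (hc e).isOpen_compl
  have htmem : t ∈ ⋂ e ∈ F, {t | c t e = true}ᶜ := by simpa using hF
  refine Filter.mem_of_superset (hopen.mem_nhds htmem) fun s hs => hF' _ ?_
  simpa using hs

open Classical in
/-- If two configurations differ only at finitely many edges and a vertex of the finite set `K`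
percolates in the first, then in the second some vertex percolates which is in `K` or is an end of
one of these edges. -/
lemma exists_finset_forall_percolatesFrom_of_eq_off (K : Finset G.vertexSet)
    (F : Finset G.edgeSet) : ∃ K' : Finset G.vertexSet, ∀ ω ω' : Config G,
      (∀ e ∉ F, ω e = ω' e) → (∃ x ∈ K, ω ∈ percolatesFrom G x) →
        ∃ x ∈ K', ω' ∈ percolatesFrom G x := by
  have hends : {v : G.vertexSet | ∃ e ∈ F, G.Inc e.1 v}.Finite := by
    have h1 : (⋃ e ∈ (F : Set G.edgeSet), {v : G.vertexSet | G.Inc e.1 v}).Finite := by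
      refine F.finite_toSet.biUnion fun e _ => ?_
      obtain ⟨a, b, hab⟩ := G.exists_isLink_of_mem_edgeSet e.2
      refine Set.Finite.subset (Set.toFinite {⟨a, hab.left_mem⟩, ⟨b, hab.right_mem⟩})
        fun v hv => ?_
      rcases hv.eq_or_eq_of_isLink hab with h | h
      · exact Or.inl (Subtype.ext h)
      · exact Or.inr (Subtype.ext h)
    refine h1.subset ?_
    rintro v ⟨e, he, hv⟩
    exact Set.mem_biUnion (Finset.mem_coe.2 he) hv
  refine ⟨K ∪ hends.toFinset, ?_⟩
  rintro ω ω' hω ⟨x, hxK, hx⟩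
  by_contra! hcon
  refine hx (Set.Finite.subset (Set.Finite.biUnion (Finset.finite_toSet (K ∪ hends.toFinset))
    (t := fun y => cluster G ω' y) fun y hy => Set.not_infinite.1 (hcon y hy)) fun y hy => ?_)
  induction hy with
  | refl =>
    refine Set.mem_biUnion (x := x) (Finset.mem_coe.2 (Finset.mem_union_left _ hxK)) ?_
    exact Relation.ReflTransGen.refl
  | @tail z w _ hzw ih =>
    obtain ⟨e, he, hl⟩ := hzw
    by_cases heF : e ∈ F
    · refine Set.mem_biUnion (x := (⟨w, hl.right_mem⟩ : G.vertexSet)) (Finset.mem_coe.2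
        (Finset.mem_union_right _ ((Set.Finite.mem_toFinset _).2 ⟨e, heF, hl.inc_right⟩))) ?_
      exact Relation.ReflTransGen.refl
    · obtain ⟨y, hy, hz⟩ := Set.mem_iUnion₂.1 ih
      refine Set.mem_biUnion hy (Relation.ReflTransGen.tail hz ⟨e, ?_, hl⟩)
      rw [← hω e heF, he]

lemma countable_vertexSet (hconn : Connected G) (hfin : LocallyFinite G) :
    G.vertexSet.Countable := by
  obtain ⟨⟨x, hx⟩, hconn⟩ := hconn
  let N : Set V → Set V := fun S => {w | ∃ v ∈ S, G.Adj v w}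
  have hN : ∀ S, S.Countable → S ⊆ G.vertexSet → (N S).Countable := by
    intro S hS hSV
    have : N S = ⋃ v ∈ S, {w | G.Adj v w} := by ext; simp [N]
    rw [this]
    refine hS.biUnion fun v hv => Set.Finite.countable ?_
    refine Set.Finite.subset ((hfin v (hSV hv)).biUnion (t := fun e => {w | G.IsLink e v w})
      fun e _ => ?_) ?_
    · exact Set.Subsingleton.finite fun a ha b hb => ha.right_unique hb
    · rintro w ⟨e, he⟩
      exact Set.mem_biUnion (x := e) he.inc_left he
  have hiter : ∀ n, (N^[n] {x}).Countable ∧ N^[n] {x} ⊆ G.vertexSet := by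
    intro n
    induction n with
    | zero => simpa using hx
    | succ n ih =>
      rw [Function.iterate_succ_apply']
      refine ⟨hN _ ih.1 ih.2, ?_⟩
      rintro w ⟨v, -, hvw⟩
      exact hvw.right_mem
  refine (Set.countable_iUnion fun n => (hiter n).1).mono fun y hy => ?_
  have := hconn x hx y hy
  induction this with
  | refl => exact Set.mem_iUnion.2 ⟨0, rfl⟩
  | @tail z w _ hzw ih =>
    obtain ⟨n, hn⟩ := Set.mem_iUnion.1 (ih hzw.left_mem)
    refine Set.mem_iUnion.2 ⟨n + 1, ?_⟩
    rw [Function.iterate_succ_apply']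
    exact ⟨z, hn, hzw⟩

lemma countable_edgeSet (hconn : Connected G) (hfin : LocallyFinite G) :
    G.edgeSet.Countable := by
  refine ((countable_vertexSet hconn hfin).biUnion fun v hv => (hfin v hv).countable).mono
    fun e he => ?_
  obtain ⟨u, v, huv⟩ := G.exists_isLink_of_mem_edgeSet he
  exact Set.mem_biUnion huv.left_mem huv.inc_left

lemma measurableSet_percolatesFrom (hconn : Connected G) (hfin : LocallyFinite G) {x : V}
    (hx : x ∈ G.vertexSet) : MeasurableSet (percolatesFrom G x) := by
  have := (countable_edgeSet hconn hfin).to_subtype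
  exact (isClosed_percolatesFrom hfin hx).measurableSet

end Clusters

/-! ### Independent families -/

section Independence

open Filter

variable {ι Ω : Type*} {β : ι → Type*} [mβ : ∀ i, MeasurableSpace (β i)] [mΩ : MeasurableSpace Ω]
  {P : Measure Ω} [IsProbabilityMeasure P] {Y : ∀ i, Ω → β i}

open Classical in
/-- An event that depends only on the coordinates in `S` is measurable with respect to the
σ-algebra generated by these coordinates. -/
lemma measurableSet_iSup_comap_of_dependsOn (P : Measure Ω) [IsProbabilityMeasure P]
    (Y : ∀ i, Ω → β i) (S : Set ι) {D : Set (∀ i, β i)} (hD : MeasurableSet D)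
    (hDS : DependsOn (· ∈ D) S) :
    MeasurableSet[⨆ i ∈ S, (mβ i).comap (Y i)] {ω | (fun i => Y i ω) ∈ D} := by
  obtain ⟨ω₀⟩ : Nonempty Ω := nonempty_of_isProbabilityMeasure P
  -- outside `S` the coordinates may be frozen at arbitrary values
  let Z : Ω → ∀ i, β i := fun ω i => if i ∈ S then Y i ω else Y i ω₀
  have hZ : Measurable[⨆ i ∈ S, (mβ i).comap (Y i)] Z := by
    refine @measurable_pi_lambda _ _ _ (_) _ _ fun i => ?_
    by_cases hi : i ∈ S
    · simp only [Z, hi, if_true]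
      exact (comap_measurable (Y i)).mono
        (le_iSup₂ (f := fun i (_ : i ∈ S) => (mβ i).comap (Y i)) i hi) le_rfl
    · simp only [Z, hi, if_false]
      exact measurable_const
  have : {ω | (fun i => Y i ω) ∈ D} = Z ⁻¹' D := by
    ext ω
    exact (hDS (x := fun i => Y i ω) (y := Z ω) fun i hi => by simp [Z, hi]).to_iff
  rw [this]
  exact hZ hD

lemma measure_inter_eq_mul_of_dependsOn_compl (hY : ∀ i, Measurable (Y i)) (h : iIndepFun Y P)
    (e : ι) {B : Set (β e)} (hB : MeasurableSet B) {D : Set (∀ i, β i)} (hD : MeasurableSet D)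
    (hDe : DependsOn (· ∈ D) {e}ᶜ) :
    P ({ω | Y e ω ∈ B} ∩ {ω | (fun i => Y i ω) ∈ D})
      = P {ω | Y e ω ∈ B} * P {ω | (fun i => Y i ω) ∈ D} := by
  have hind := indep_iSup_of_disjoint (m := fun i => (mβ i).comap (Y i)) (S := {e}) (T := {e}ᶜ)
    (fun i => (hY i).comap_le) h disjoint_compl_right
  refine (Indep_iff _ _ P).1 hind _ _ ?_ (measurableSet_iSup_comap_of_dependsOn P Y _ hD hDe)
  exact le_iSup₂ (f := fun i (_ : i ∈ ({e} : Set ι)) => (mβ i).comap (Y i)) e rfl _ ⟨B, hB, rfl⟩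

/-- Kolmogorov's 0-1 law, for events insensitive to the values of finitely many coordinates. -/
lemma measure_eq_zero_or_one_of_dependsOn_compl_finset (hY : ∀ i, Measurable (Y i))
    (h : iIndepFun Y P) {D : Set (∀ i, β i)} (hD : MeasurableSet D)
    (hDF : ∀ F : Finset ι, DependsOn (· ∈ D) (F : Set ι)ᶜ) :
    P {ω | (fun i => Y i ω) ∈ D} = 0 ∨ P {ω | (fun i => Y i ω) ∈ D} = 1 := by
  refine measure_zero_or_one_of_measurableSet_limsup (s := fun i => (mβ i).comap (Y i))
    (f := cofinite) (p := Set.Finite) (ns := fun F : Finset ι => (F : Set ι))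
    (fun i => (hY i).comap_le) h (fun t ht => ht.compl_mem_cofinite) ?_
    (fun F => F.finite_toSet) (fun i => ⟨{i}, by simp⟩) ?_
  · classical
    exact fun F F' => ⟨F ∪ F', by simp, by simp⟩
  · rw [hasBasis_cofinite.limsup_eq_iInf_iSup]
    simp only [MeasurableSpace.measurableSet_iInf]
    intro S hS
    have := measurableSet_iSup_comap_of_dependsOn P Y Sᶜ hD (by simpa using hDF hS.toFinset)
    simpa using this

end Independence

section Hybrid

variable {ι Ω : Type*} [mΩ : MeasurableSpace Ω] {P : Measure Ω} [IsProbabilityMeasure P]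

lemma measurable_update_not [DecidableEq ι] (e : ι) :
    Measurable fun c : ι → Bool => Function.update c e (!c e) := by
  refine measurable_pi_lambda _ fun i => ?_
  by_cases hi : i = e
  · subst hi
    simpa [Function.comp_def] using (measurable_of_finite Bool.not).comp (measurable_pi_apply i)
  · simpa [Function.update_of_ne hi] using measurable_pi_apply i

lemma measurableSet_not_iff {α : Type*} [MeasurableSpace α] {s t : Set α} (hs : MeasurableSet s)
    (ht : MeasurableSet t) : MeasurableSet {a | ¬ (a ∈ s ↔ a ∈ t)} :=
  (Measurable.iff hs.mem ht.mem).not.setOf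

open Classical in
/-- Whether `e` is pivotal does not depend on the status of `e`. -/
lemma dependsOn_pivotal (A : Set (ι → Bool)) (e : ι) :
    DependsOn (· ∈ {c : ι → Bool | ¬ (Function.update c e (!c e) ∈ A ↔ c ∈ A)}) {e}ᶜ := by
  intro c c' hcc
  have h1 : ∀ b, Function.update c e b = Function.update c' e b := by
    intro b
    ext i
    by_cases hi : i = e
    · subst hi; simp
    · simpa [Function.update_of_ne hi] using hcc i hi
  have h2 : c = Function.update c' e (c e) := by rw [← h1, Function.update_eq_self]
  have h3 : c' = Function.update c' e (c' e) := by rw [Function.update_eq_self]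
  simp only [Set.mem_ofPred_eq, h1, eq_iff_iff]
  rcases Bool.eq_or_eq_not (c e) (c' e) with h | h
  · rw [h, ← h3] at h2
    rw [h, h2]
  · rw [h] at h2
    rw [h, h2]
    simp only [Bool.not_not, Function.update_eq_self]
    tauto

open Classical in
/-- If two random configurations `X` and `Y` have independent coordinates and the same product law,
then the probability that exactly one of them lies in `A` is bounded by resampling the coordinates
one at a time. -/
lemma measure_not_mem_iff_mem_le {X Y : ι → Ω → Bool} (hX : ∀ i, Measurable (X i))
    (hY : ∀ i, Measurable (Y i)) (h : iIndepFun (fun i ω => (X i ω, Y i ω)) P)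
    {μ : ι → Measure Bool} (hμX : ∀ i, P.map (X i) = μ i) (hμY : ∀ i, P.map (Y i) = μ i)
    {A : Set (ι → Bool)} (hA : MeasurableSet A) :
    P {ω | ¬ ((fun i => X i ω) ∈ A ↔ (fun i => Y i ω) ∈ A)} ≤
      ∑' e, P {ω | X e ω ≠ Y e ω} * Measure.infinitePi μ
        {c | ¬ (Function.update c e (!c e) ∈ A ↔ c ∈ A)} := by
  have hμ : ∀ i, IsProbabilityMeasure (μ i) := fun i => by
    rw [← hμX i]; exact Measure.isProbabilityMeasure_map (hX i).aemeasurable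
  -- the hybrid configuration, with the coordinates in `F` taken from `Y` and the others from `X`
  let Z : Finset ι → (ι → Bool × Bool) → ι → Bool := fun F y i => if i ∈ F then (y i).2 else (y i).1
  have hZ : ∀ F, Measurable (Z F) := fun F => by
    refine measurable_pi_lambda _ fun i => ?_
    by_cases hi : i ∈ F
    · simpa [Z, hi] using (measurable_pi_apply i).snd
    · simpa [Z, hi] using (measurable_pi_apply i).fst
  let W : Ω → ι → Bool × Bool := fun ω i => (X i ω, Y i ω)
  have hWi : ∀ i, Measurable fun ω => (X i ω, Y i ω) := fun i => (hX i).prodMk (hY i)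
  have hW : Measurable W := measurable_pi_lambda _ hWi
  have hlaw : ∀ F, P.map (fun ω => Z F (W ω)) = Measure.infinitePi μ := by
    intro F
    have hmeas : ∀ i, Measurable fun p : Bool × Bool => if i ∈ F then p.2 else p.1 :=
      fun i => measurable_of_finite _
    have := (h.comp (fun i p => if i ∈ F then p.2 else p.1) hmeas).map_fun_eq_infinitePi_map
      (fun i => (hmeas i).comp (hWi i))
    refine this.trans ?_
    congr 1
    ext1 i
    by_cases hi : i ∈ F
    · simpa [hi, Function.comp_def] using hμY i
    · simpa [hi, Function.comp_def] using hμX i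
  have hlawY : P.map (fun ω i => Y i ω) = Measure.infinitePi μ := by
    have := (h.comp (fun i p => p.2) fun i => measurable_snd).map_fun_eq_infinitePi_map
      (fun i => measurable_snd.comp (hWi i))
    refine this.trans ?_
    congr 1
    ext1 i
    exact hμY i
  have hYm : Measurable fun ω i => Y i ω := measurable_pi_lambda _ hY
  have hpiv : ∀ e, MeasurableSet {c : ι → Bool | ¬ (Function.update c e (!c e) ∈ A ↔ c ∈ A)} :=
    fun e => measurableSet_not_iff (measurable_update_not e hA) hA
  set b : ι → ℝ≥0∞ := fun e => P {ω | X e ω ≠ Y e ω} * Measure.infinitePi μ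
        {c | ¬ (Function.update c e (!c e) ∈ A ↔ c ∈ A)} with hb
  have hstep : ∀ (F : Finset ι) (e : ι), e ∉ F →
      P {ω | ¬ (Z F (W ω) ∈ A ↔ Z (insert e F) (W ω) ∈ A)} ≤ b e := by
    intro F e he
    have hdep : DependsOn (· ∈ Z F ⁻¹' {c | ¬ (Function.update c e (!c e) ∈ A ↔ c ∈ A)}) {e}ᶜ := by
      intro y y' hyy
      refine dependsOn_pivotal A e fun i hi => ?_
      simp only [Z, hyy i hi]
    have hmul := measure_inter_eq_mul_of_dependsOn_compl hWi h e
      (B := {p : Bool × Bool | p.1 ≠ p.2}) (Set.toFinite _).measurableSet (hZ F (hpiv e)) hdep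
    have hmap : P {ω | (fun i => (X i ω, Y i ω)) ∈
        Z F ⁻¹' {c | ¬ (Function.update c e (!c e) ∈ A ↔ c ∈ A)}} = Measure.infinitePi μ
        {c | ¬ (Function.update c e (!c e) ∈ A ↔ c ∈ A)} := by
      rw [← hlaw F, Measure.map_apply (by exact (hZ F).comp hW) (hpiv e)]
      rfl
    rw [hmap] at hmul
    rw [hb]
    refine le_trans (measure_mono ?_) hmul.le
    intro ω hω
    have hXY : X e ω ≠ Y e ω := by
      intro heq
      refine hω ?_
      have : Z F (W ω) = Z (insert e F) (W ω) := by
        ext i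
        by_cases hi : i = e
        · subst hi; simp [Z, W, he, heq]
        · simp [Z, hi]
      rw [this]
    refine ⟨hXY, ?_⟩
    have : Function.update (Z F (W ω)) e (!Z F (W ω) e) = Z (insert e F) (W ω) := by
      ext i
      by_cases hi : i = e
      · subst hi
        have := Bool.eq_not_of_ne hXY.symm
        simp [Z, W, he, this]
      · simp [Z, hi]
    change ¬ (Function.update (Z F (W ω)) e (!Z F (W ω) e) ∈ A ↔ Z F (W ω) ∈ A)
    rw [this]
    exact fun h => hω h.symm
  have hsum : ∀ F : Finset ι, P {ω | ¬ (Z ∅ (W ω) ∈ A ↔ Z F (W ω) ∈ A)} ≤ ∑ e ∈ F, b e := by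
    intro F
    induction F using Finset.induction_on with
    | empty => simp
    | insert e F he ih =>
      rw [Finset.sum_insert he, add_comm]
      refine le_trans (measure_mono ?_)
        ((measure_union_le _ _).trans (add_le_add ih (hstep F e he)))
      intro ω hω
      simp only [Set.mem_union, Set.mem_ofPred_eq] at hω ⊢
      tauto
  have hZ0 : ∀ ω, Z ∅ (W ω) = fun i => X i ω := fun ω => by ext i; simp [Z, W]
  -- approximate `A` by an event depending on finitely many coordinates only
  refine ENNReal.le_of_forall_pos_le_add fun ε hε _ => ?_
  obtain ⟨C, hC, hCA⟩ := exists_measure_symmDiff_lt_of_generateFrom_isSetRing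
    (μ := Measure.infinitePi μ) (isSetRing_measurableCylinders (α := fun _ : ι => Bool))
    ⟨{Set.univ}, Set.countable_singleton _,
      Set.singleton_subset_iff.2 (univ_mem_measurableCylinders _), by simp⟩
    generateFrom_measurableCylinders.symm hA (ε := (ε / 2 : ℝ≥0)) (by positivity)
  obtain ⟨F, S, hS, rfl⟩ := (mem_measurableCylinders C).1 hC
  have hCm : MeasurableSet (cylinder (α := fun _ : ι => Bool) F S) := .cylinder F hS
  have hdiff : MeasurableSet (symmDiff (cylinder F S) A) := hCm.symmDiff hA
  have h1 : P {ω | Z F (W ω) ∈ symmDiff (cylinder F S) A} ≤ (ε / 2 : ℝ≥0) := by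
    rw [← hlaw F, Measure.map_apply (by exact (hZ F).comp hW) hdiff] at hCA
    exact hCA.le
  have h2 : P {ω | (fun i => Y i ω) ∈ symmDiff (cylinder F S) A} ≤ (ε / 2 : ℝ≥0) := by
    rw [← hlawY, Measure.map_apply hYm hdiff] at hCA
    exact hCA.le
  have hcyl : ∀ ω, Z F (W ω) ∈ cylinder F S ↔ (fun i => Y i ω) ∈ cylinder F S := by
    intro ω
    have : F.restrict (Z F (W ω)) = F.restrict (fun i => Y i ω) := by
      ext i; simp [Z, W]
    simp only [mem_cylinder, this]
  calc P {ω | ¬ ((fun i => X i ω) ∈ A ↔ (fun i => Y i ω) ∈ A)}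
      ≤ P ({ω | ¬ (Z ∅ (W ω) ∈ A ↔ Z F (W ω) ∈ A)} ∪
          ({ω | Z F (W ω) ∈ symmDiff (cylinder F S) A} ∪
            {ω | (fun i => Y i ω) ∈ symmDiff (cylinder F S) A})) := by
        refine measure_mono fun ω hω => ?_
        have := hcyl ω
        simp only [Set.mem_union, Set.mem_ofPred_eq, hZ0, Set.mem_symmDiff] at hω ⊢
        tauto
    _ ≤ ∑ e ∈ F, b e + ((ε / 2 : ℝ≥0) + (ε / 2 : ℝ≥0)) :=
        (measure_union_le _ _).trans (add_le_add (hsum F)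
          ((measure_union_le _ _).trans (add_le_add h1 h2)))
    _ ≤ ∑' e, b e + ε := by
        refine add_le_add (ENNReal.sum_le_tsum F) (le_of_eq ?_)
        rw [← ENNReal.coe_add, add_halves]

end Hybrid

/-! ### The stationary two-state chain -/

section Chain

variable {Ω : Type*} [MeasurableSpace Ω] {P : Measure Ω}
  {X : ℝ≥0 → Ω → Bool}

lemma IsStationaryChain.real_eq {p : ℝ} (hX : IsStationaryChain P p X) (t : ℝ≥0) (a : Bool) :
    P.real {ω | X t ω = a} = stationary p a := by
  simpa using hX.2 0 (fun _ => t) (fun _ => a) monotone_const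

lemma IsStationaryChain.map_eq [IsProbabilityMeasure P] {p : I}
    (hX : IsStationaryChain P p X) (t : ℝ≥0) :
    P.map (X t) = bernoulliMeasure true false p := by
  have := Measure.isProbabilityMeasure_map (μ := P) (hX.1 t).aemeasurable
  refine Measure.ext_of_measureReal_singleton fun a => ?_
  rw [map_measureReal_apply (hX.1 t) (measurableSet_singleton a),
    bernoulliMeasure_real_apply _ (measurableSet_singleton a)]
  refine (hX.real_eq t a).trans ?_
  cases a <;> simp [stationary]

/-- The chain is at different states at times `s ≤ t` with probability at most `t - s`. -/
lemma IsStationaryChain.measure_ne_le [IsProbabilityMeasure P] {p : I}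
    (hX : IsStationaryChain P p X) {s t : ℝ≥0} (hst : s ≤ t) :
    P {ω | X s ω ≠ X t ω} ≤ ENNReal.ofReal ((t : ℝ) - s) := by
  have hjoint : ∀ a b, P.real {ω | X s ω = a ∧ X t ω = b} =
      stationary p a * transition p ((t : ℝ) - s) a b := by
    intro a b
    have hmono : Monotone fun n : ℕ => if n = 0 then s else t := by
      refine monotone_nat_of_le_succ fun n => ?_
      rcases n with _ | n <;> simp [hst]
    have := hX.2 1 (fun n => if n = 0 then s else t) (fun n => if n = 0 then a else b) hmono
    have hset : {ω | ∀ i ≤ 1, X (if i = 0 then s else t) ω = if i = 0 then a else b}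
        = {ω | X s ω = a ∧ X t ω = b} := by
      ext ω
      simp only [Set.mem_ofPred_eq]
      refine ⟨fun h => ⟨by simpa using h 0 (by simp), by simpa using h 1 le_rfl⟩, ?_⟩
      rintro ⟨h0, h1⟩ i hi
      interval_cases i <;> simpa
    rw [hset] at this
    simpa using this
  have hsub : {ω | X s ω ≠ X t ω} ⊆
      {ω | X s ω = true ∧ X t ω = false} ∪ {ω | X s ω = false ∧ X t ω = true} := by
    intro ω hω
    cases h1 : X s ω <;> cases h2 : X t ω <;> simp_all
  have hle : P.real {ω | X s ω ≠ X t ω} ≤ (t : ℝ) - s := by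
    have hd : (0 : ℝ) ≤ (t : ℝ) - s := sub_nonneg.2 (by exact_mod_cast hst)
    refine (measureReal_mono hsub).trans ((measureReal_union_le _ _).trans ?_)
    rw [hjoint, hjoint]
    simp only [transition, stationary]
    have h1 := Real.add_one_le_exp (-((t : ℝ) - s))
    have h2 : Real.exp (-((t : ℝ) - s)) ≤ 1 := Real.exp_le_one_iff.2 (by linarith)
    have h3 : (p : ℝ) * (1 - p) ≤ 1 / 4 := by nlinarith [sq_nonneg ((p : ℝ) - 1 / 2)]
    have h4 : 0 ≤ (p : ℝ) * (1 - p) := mul_nonneg p.2.1 (by linarith [p.2.2])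
    simp only [Bool.true_eq_false, Bool.false_eq_true, if_false]
    nlinarith
  exact (ENNReal.le_ofReal_iff_toReal_le (measure_ne_top _ _)
    (sub_nonneg.2 (by exact_mod_cast hst))).2 hle

/-- The finite-dimensional distributions at an arbitrary finite set of times, shifted by `s`, do not
depend on `s`. -/
lemma IsStationaryChain.real_forall_mem_shift_eq [IsProbabilityMeasure P] {p : ℝ}
    (hX : IsStationaryChain P p X) (s : ℝ≥0) (J : Finset ℝ≥0)
    (a : ℝ≥0 → Bool) :
    P.real {ω | ∀ t ∈ J, X (s + t) ω = a t} = P.real {ω | ∀ t ∈ J, X t ω = a t} := by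
  rcases Nat.eq_zero_or_pos J.card with hJ | hJ
  · simp [Finset.card_eq_zero.1 hJ]
  -- the increasing enumeration of `J`, which stays at the largest element of `J`
  let u : ℕ → ℝ≥0 := fun i =>
    J.orderEmbOfFin rfl ⟨min i (J.card - 1), by omega⟩
  have hu : Monotone u := fun i j hij =>
    (J.orderEmbOfFin rfl).monotone (by simp only [Fin.mk_le_mk]; omega)
  have hset : ∀ r : ℝ≥0, {ω | ∀ t ∈ J, X (r + t) ω = a t} =
      {ω | ∀ i ≤ J.card - 1, X (r + u i) ω = a (u i)} := by
    intro r
    ext ω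
    refine ⟨fun h i _ => h _ (J.orderEmbOfFin_mem rfl _), fun h t ht => ?_⟩
    obtain ⟨k, hk⟩ : ∃ k, J.orderEmbOfFin rfl k = t := by
      rw [← Set.mem_range, Finset.range_orderEmbOfFin]; exact ht
    have hk' : u k = t := by
      rw [← hk]
      simp only [u]
      congr 1
      ext
      simp only
      omega
    have := h k (by omega)
    rwa [hk'] at this
  have key : ∀ r : ℝ≥0, P.real {ω | ∀ t ∈ J, X (r + t) ω = a t} = stationary p (a (u 0)) *
        ∏ i ∈ Finset.range (J.card - 1),
          transition p ((u (i + 1) : ℝ) - (u i : ℝ)) (a (u i)) (a (u (i + 1))) := by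
    intro r
    rw [hset, hX.2 (J.card - 1) (fun i => r + u i) (fun i => a (u i))
      fun i j hij => add_le_add le_rfl (hu hij)]
    simp
  have h0 := key 0
  simp only [zero_add] at h0
  rw [key, h0]

/-- The law of the path of the chain is invariant under time shifts. -/
lemma IsStationaryChain.map_shift_eq [IsProbabilityMeasure P] {p : ℝ}
    (hX : IsStationaryChain P p X) (s : ℝ≥0) :
    P.map (fun ω t => X (s + t) ω) = P.map (fun ω t => X t ω) := by
  classical
  have hm : ∀ r : ℝ≥0, Measurable fun ω t => X (r + t) ω :=
    fun r => measurable_pi_lambda _ fun t => hX.1 _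
  have hm' : Measurable fun ω t => X t ω := measurable_pi_lambda _ fun t => hX.1 _
  refine (map_eq_iff_forall_finset_map_restrict_eq (P := P) (X := fun t => X (s + t)) (Y := X)
    (hm s).aemeasurable hm'.aemeasurable).2 fun J => ?_
  have hr : Measurable fun ω => J.restrict (fun t => X (s + t) ω) :=
    (Finset.measurable_restrict J).comp (hm s)
  have hr' : Measurable fun ω => J.restrict (fun t => X t ω) :=
    (Finset.measurable_restrict J).comp hm'
  have := Measure.isProbabilityMeasure_map (μ := P) hr.aemeasurable
  have := Measure.isProbabilityMeasure_map (μ := P) hr'.aemeasurable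
  refine Measure.ext_of_measureReal_singleton fun a => ?_
  rw [map_measureReal_apply hr (measurableSet_singleton a),
    map_measureReal_apply hr' (measurableSet_singleton a)]
  have hset : ∀ Z : ℝ≥0 → Ω → Bool, (fun ω => J.restrict (fun t => Z t ω)) ⁻¹' {a} =
      {ω | ∀ t ∈ J, Z t ω = (fun t => if h : t ∈ J then a ⟨t, h⟩ else false) t} := by
    intro Z
    ext ω
    simp only [Set.mem_preimage, Set.mem_singleton_iff, Set.mem_ofPred_eq, funext_iff,
      Finset.restrict, Subtype.forall]
    refine forall₂_congr fun t ht => ?_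
    simp [ht]
  rw [hset, hset]
  exact hX.real_forall_mem_shift_eq s J _

end Chain

/-! ### Functions of bounded variation on the line -/

section BoundedVariation

open Filter Topology

lemma eVariationOn_sub_le {α : Type*} [LinearOrder α] (f g : α → ℝ) (s : Set α) :
    eVariationOn (f - g) s ≤ eVariationOn f s + eVariationOn g s := by
  refine iSup_le fun ⟨n, u, hu, us⟩ => ?_
  calc ∑ i ∈ Finset.range n, edist ((f - g) (u (i + 1))) ((f - g) (u i))
      ≤ ∑ i ∈ Finset.range n,
          (edist (f (u (i + 1))) (f (u i)) + edist (g (u (i + 1))) (g (u i))) :=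
        Finset.sum_le_sum fun i _ => by
          simp only [Pi.sub_apply, edist_eq_enorm_sub]
          rw [sub_sub_sub_comm]
          exact enorm_sub_le
    _ ≤ _ := by
        rw [Finset.sum_add_distrib]
        exact add_le_add (eVariationOn.sum_le hu us) (eVariationOn.sum_le hu us)

/-- A real function of bounded variation on an arbitrary set of reals extends from this set to a
function of bounded variation on every compact interval. -/
lemma exists_boundedVariationOn_extension {f : ℝ → ℝ} {S : Set ℝ} (hf : BoundedVariationOn f S)
    (a b : ℝ) : ∃ g : ℝ → ℝ, BoundedVariationOn g (Set.Icc a b) ∧ Set.EqOn f g S := by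
  rcases S.eq_empty_or_nonempty with rfl | ⟨c, hc⟩
  · exact ⟨0, (monotone_const.monotoneOn _).boundedVariationOn (C := 0) (by simp),
      Set.eqOn_empty _ _⟩
  obtain ⟨p, q, hp, hq, hpq, hvar⟩ :=
    hf.locallyBoundedVariationOn.exists_monotoneOn_sub_monotoneOn'
  set v := (eVariationOn f S).toReal
  have hv : ∀ x ∈ S, ∀ y ∈ S, x ≤ y → (p y - p x) + (q y - q x) ≤ v := by
    intro x hx y hy hxy
    rw [hvar x hx y hy, variationOnFromTo.eq_of_le _ _ hxy]
    exact ENNReal.toReal_mono hf (eVariationOn.mono _ Set.inter_subset_left)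
  have hbound : ∀ r r' : ℝ → ℝ, MonotoneOn r S → MonotoneOn r' S →
      (∀ x ∈ S, ∀ y ∈ S, x ≤ y → (r y - r x) + (r' y - r' x) ≤ v) → ∃ R : ℝ → ℝ, Monotone R ∧
        Set.EqOn r R S := by
    intro r r' hr hr' h
    have hle : ∀ x ∈ S, |r x - r c| ≤ v := by
      intro x hx
      rcases le_total x c with hxc | hxc
      · have h1 := h x hx c hc hxc
        have h2 := hr hx hc hxc
        have h3 := hr' hx hc hxc
        rw [abs_le]
        constructor <;> linarith
      · have h1 := h c hc x hx hxc
        have h2 := hr hc hx hxc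
        have h3 := hr' hc hx hxc
        rw [abs_le]
        constructor <;> linarith
    refine hr.exists_monotone_extension ⟨r c - v, ?_⟩ ⟨r c + v, ?_⟩
    · rintro _ ⟨x, hx, rfl⟩
      linarith [(abs_le.1 (hle x hx)).1]
    · rintro _ ⟨x, hx, rfl⟩
      linarith [(abs_le.1 (hle x hx)).2]
  obtain ⟨p', hp', hpp'⟩ := hbound p q hp hq hv
  obtain ⟨q', hq', hqq'⟩ := hbound q p hq hp fun x hx y hy hxy => by linarith [hv x hx y hy hxy]
  have hmono : ∀ r : ℝ → ℝ, Monotone r → eVariationOn r (Set.Icc a b) ≠ ⊤ := by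
    intro r hr
    refine (hr.monotoneOn _).boundedVariationOn (C := max |r a| |r b|) fun x hx => ?_
    exact abs_le_max_abs_abs (hr hx.1) (hr hx.2)
  refine ⟨p' - q', ne_top_of_le_ne_top (ENNReal.add_ne_top.2 ⟨hmono _ hp', hmono _ hq'⟩)
    (eVariationOn_sub_le p' q' _), fun x hx => ?_⟩
  rw [hpq]
  simp [hpp' hx, hqq' hx]

/-- The variation of the moving average of `f` over windows of length `h` is at most the
`L¹`-norm of the difference quotient. -/
lemma eVariationOn_average_le {f : ℝ → ℝ} (hf : LocallyIntegrable f volume) {h : ℝ} (hh : 0 < h)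
    {a b : ℝ} :
    eVariationOn (fun t => h⁻¹ * ∫ u in t..t + h, f u) (Set.Icc a b) ≤
      ENNReal.ofReal h⁻¹ * ∫⁻ u in Set.Icc a b, ‖f (u + h) - f u‖ₑ := by
  have hint : ∀ x y : ℝ, IntervalIntegrable f volume x y := fun x y =>
    intervalIntegrable_iff.mpr <|
      (hf.integrableOn_isCompact isCompact_uIcc).mono_set Set.uIoc_subset_uIcc
  refine iSup_le fun ⟨n, u, hu, us⟩ => ?_
  have hstep : ∀ i, edist (h⁻¹ * ∫ v in u (i + 1)..u (i + 1) + h, f v)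
      (h⁻¹ * ∫ v in u i..u i + h, f v) ≤
        ENNReal.ofReal h⁻¹ * ∫⁻ v in Set.Ioc (u i) (u (i + 1)), ‖f (v + h) - f v‖ₑ := by
    intro i
    have heq : (∫ v in u (i + 1)..u (i + 1) + h, f v) - ∫ v in u i..u i + h, f v
        = ∫ v in u i..u (i + 1), (f (v + h) - f v) := by
      have hshift : IntervalIntegrable (fun v => f (v + h)) volume (u i) (u (i + 1)) := by
        simpa using (hint (u i + h) (u (i + 1) + h)).comp_add_right h
      rw [intervalIntegral.integral_sub hshift (hint _ _),
        intervalIntegral.integral_comp_add_right]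
      have h1 := intervalIntegral.integral_add_adjacent_intervals (hint (u i) (u i + h))
        (hint (u i + h) (u (i + 1) + h))
      have h2 := intervalIntegral.integral_add_adjacent_intervals (hint (u i) (u (i + 1)))
        (hint (u (i + 1)) (u (i + 1) + h))
      linarith
    rw [edist_eq_enorm_sub, ← mul_sub, heq, enorm_mul, Real.enorm_of_nonneg (by positivity),
      intervalIntegral.integral_of_le (hu (Nat.le_succ i))]
    gcongr
    exact enorm_integral_le_lintegral_enorm _
  have hsum : ∀ m, ∑ i ∈ Finset.range m,
      ∫⁻ v in Set.Ioc (u i) (u (i + 1)), ‖f (v + h) - f v‖ₑ =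
        ∫⁻ v in Set.Ioc (u 0) (u m), ‖f (v + h) - f v‖ₑ := by
    intro m
    induction m with
    | zero => simp
    | succ m ih =>
      rw [Finset.sum_range_succ, ih, ← lintegral_union measurableSet_Ioc,
        Set.Ioc_union_Ioc_eq_Ioc (hu (Nat.zero_le m)) (hu (Nat.le_succ m))]
      exact Set.Ioc_disjoint_Ioc_of_le le_rfl
  calc _ ≤ ∑ i ∈ Finset.range n,
        ENNReal.ofReal h⁻¹ * ∫⁻ v in Set.Ioc (u i) (u (i + 1)), ‖f (v + h) - f v‖ₑ :=
        Finset.sum_le_sum fun i _ => hstep i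
    _ = ENNReal.ofReal h⁻¹ * ∫⁻ v in Set.Ioc (u 0) (u n), ‖f (v + h) - f v‖ₑ := by
        rw [← Finset.mul_sum, hsum]
    _ ≤ _ := by
        gcongr
        exact Set.Ioc_subset_Icc_self.trans (Set.Icc_subset_Icc (us 0).1 (us n).2)

/-- If the `L¹`-norms of the difference quotients of `f` are bounded along a sequence of step sizes
tending to `0`, then `f` is almost everywhere equal to a function of bounded variation. -/
lemma aeEqBoundedVariation_of_frequently {f : ℝ → ℝ} (hf : LocallyIntegrable f volume) {M : ℝ≥0∞}
    (hM : M ≠ ⊤) {h : ℕ → ℝ} (hpos : ∀ n, 0 < h n) (hlim : Tendsto h atTop (𝓝 0))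
    (hfreq : ∃ᶠ n in atTop,
      ENNReal.ofReal (h n)⁻¹ * ∫⁻ u in Set.Icc (0 : ℝ) 1, ‖f (u + h n) - f u‖ₑ ≤ M) :
    AEEqBoundedVariation f := by
  have hint : ∀ x y : ℝ, IntervalIntegrable f volume x y := fun x y =>
    intervalIntegrable_iff.mpr <|
      (hf.integrableOn_isCompact isCompact_uIcc).mono_set Set.uIoc_subset_uIcc
  let F : ℕ → ℝ → ℝ := fun n t => (h n)⁻¹ * ∫ u in t..t + h n, f u
  let S : Set ℝ := {t | Tendsto (fun n => F n t) atTop (𝓝 (f t))}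
  have hS : ∀ᵐ t, t ∈ S := by
    filter_upwards [LocallyIntegrable.ae_hasDerivAt_integral hf] with t ht
    have h1 := hasDerivAt_iff_tendsto_slope_zero.1 (ht 0)
    have h2 : Tendsto h atTop (𝓝[≠] 0) :=
      tendsto_nhdsWithin_iff.2 ⟨hlim, Eventually.of_forall fun n => (hpos n).ne'⟩
    refine (h1.comp h2).congr fun n => ?_
    simp only [Function.comp_apply, smul_eq_mul, F]
    rw [intervalIntegral.integral_interval_sub_left (hint _ _) (hint _ _)]
  have hBV : BoundedVariationOn f (S ∩ Set.Icc 0 1) := by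
    refine ne_top_of_le_ne_top hM (le_of_not_gt fun hlt => ?_)
    have hev := eVariationOn.lowerSemicontinuous_aux (F := F) (p := atTop) (s := S ∩ Set.Icc 0 1)
      (fun t ht => ht.1) hlt
    obtain ⟨n, hn, hn'⟩ := (hfreq.and_eventually hev).exists
    refine absurd (hn'.trans_le ((eVariationOn.mono _ Set.inter_subset_right).trans
      (eVariationOn_average_le hf (hpos n)))) (not_lt.2 hn)
  obtain ⟨g, hg, hfg⟩ := exists_boundedVariationOn_extension hBV 0 1
  refine ⟨g, hg, ?_⟩
  filter_upwards [ae_restrict_of_ae hS, ae_restrict_mem measurableSet_Icc] with t ht ht'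
  exact hfg ⟨ht, ht'⟩

/-- A function with values in `{0, 1}` that is almost everywhere equal to a function of bounded
variation and does not vanish almost everywhere is equal to `1` almost everywhere on some interval:
take a point where the function of bounded variation is continuous and equal to `1`. -/
lemma AEEqBoundedVariation.exists_interval {f : ℝ → ℝ} (hf : AEEqBoundedVariation f)
    (h01 : ∀ t, f t = 0 ∨ f t = 1)
    (hne : ¬ ∀ᵐ t ∂(volume.restrict (Set.Icc (0 : ℝ) 1)), f t = 0) :
    ∃ a b : ℚ, 0 ≤ a ∧ a < b ∧ ∀ᵐ t ∂(volume.restrict (Set.Ioo (a : ℝ) b)), f t = 1 := by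
  obtain ⟨g, hg, hfg⟩ := hf
  have hdiff : ∀ᵐ t, t ∈ Set.uIcc (0 : ℝ) 1 → DifferentiableAt ℝ g t :=
    BoundedVariationOn.ae_differentiableAt_of_mem_uIcc (by rwa [Set.uIcc_of_le zero_le_one])
  have h0 : ∀ᵐ t : ℝ, t ≠ 0 := by simp [ae_iff, measure_singleton]
  have h1 : ∀ᵐ t : ℝ, t ≠ 1 := by simp [ae_iff, measure_singleton]
  obtain ⟨t, hft, hgt, ht, hdt, ht0, ht1⟩ : ∃ t, f t ≠ 0 ∧ f t = g t ∧ t ∈ Set.Icc (0 : ℝ) 1 ∧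
      (t ∈ Set.uIcc (0 : ℝ) 1 → DifferentiableAt ℝ g t) ∧ t ≠ 0 ∧ t ≠ 1 := by
    have hfr : ∃ᵐ t ∂(volume.restrict (Set.Icc (0 : ℝ) 1)), f t ≠ 0 := by
      simpa only [Filter.Frequently, not_not] using hne
    exact (hfr.and_eventually (hfg.and ((ae_restrict_mem measurableSet_Icc).and
      ((ae_restrict_of_ae hdiff).and ((ae_restrict_of_ae h0).and (ae_restrict_of_ae h1)))))).exists
  have hcont : ContinuousAt g t := (hdt (by rwa [Set.uIcc_of_le zero_le_one])).continuousAt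
  have hg1 : g t = 1 := hgt ▸ (h01 t).resolve_left hft
  have hnhds : {s | g s ≠ 0} ∩ Set.Ioo 0 1 ∈ 𝓝 t :=
    inter_mem (hcont.eventually_ne (by simp [hg1]))
      (Ioo_mem_nhds (lt_of_le_of_ne ht.1 ht0.symm) (lt_of_le_of_ne ht.2 ht1))
  obtain ⟨l, r, ⟨hl, hr⟩, hsub⟩ := mem_nhds_iff_exists_Ioo_subset.1 hnhds
  obtain ⟨a, hla, hat⟩ := exists_rat_btwn hl
  obtain ⟨b, htb, hbr⟩ := exists_rat_btwn hr
  have hsub' : Set.Ioo (a : ℝ) b ⊆ {s | g s ≠ 0} ∩ Set.Ioo 0 1 :=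
    (Set.Ioo_subset_Ioo hla.le hbr.le).trans hsub
  have ha0 : (0 : ℝ) < a := (hsub ⟨hla, hat.trans (htb.trans hbr)⟩).2.1
  refine ⟨a, b, by exact_mod_cast ha0.le, by exact_mod_cast hat.trans htb, ?_⟩
  have hIcc : Set.Ioo (a : ℝ) b ⊆ Set.Icc 0 1 := fun s hs => Set.Ioo_subset_Icc_self (hsub' hs).2
  filter_upwards [ae_restrict_of_ae_restrict_of_subset hIcc hfg,
    ae_restrict_mem measurableSet_Ioo] with s hs hs'
  exact (h01 s).resolve_left fun h => (hsub' hs').1 (hs ▸ h)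

end BoundedVariation

/-! ### Percolation at a fixed time -/

section Static

variable {V E : Type*} {G : Graph V E}

open Classical in
/-- If `v` percolates with positive probability, then so does each neighbour `u` of `v`: opening the
edge between them is independent of the other edges and only helps. -/
lemma percMeasure_percolatesFrom_ne_zero_of_adj (hconn : Connected G) (hfin : LocallyFinite G)
    {p : G.edgeSet → I} (hp : ∀ e, 0 < p e) {u v : V} (huv : G.Adj u v)
    (hv : percMeasure G p (percolatesFrom G v) ≠ 0) :
    percMeasure G p (percolatesFrom G u) ≠ 0 := by
  obtain ⟨e, hl⟩ := huv
  have hprob : IsProbabilityMeasure (percMeasure G p) := by unfold percMeasure; infer_instance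
  let e' : G.edgeSet := ⟨e, hl.edge_mem⟩
  let D : Set (Config G) := {ω | Function.update ω e' true ∈ percolatesFrom G v}
  have hDm : MeasurableSet D :=
    measurable_update_left (measurableSet_percolatesFrom hconn hfin hl.right_mem)
  have hdep : DependsOn (· ∈ D) {e'}ᶜ := by
    intro ω ω' h
    have : Function.update ω e' true = Function.update ω' e' true := by
      ext i
      by_cases hi : i = e'
      · subst hi; simp
      · simpa [Function.update_of_ne hi] using h i hi
    simp only [D, Set.mem_ofPred_eq, this]
  have hmul := measure_inter_eq_mul_of_dependsOn_compl (P := percMeasure G p)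
    (Y := fun (i : G.edgeSet) (ω : Config G) => ω i) (fun i => measurable_pi_apply i)
    (iIndepFun_infinitePi (X := fun (_ : G.edgeSet) (b : Bool) => b) fun _ => measurable_id)
    e' (B := {true}) (measurableSet_singleton _) hDm hdep
  have hD : percMeasure G p D ≠ 0 := by
    refine fun h => hv (measure_mono_null (fun ω hω => ?_) h)
    refine percolatesFrom_mono (fun i hi => ?_) hω
    by_cases hie : i = e'
    · subst hie; simp
    · simpa [Function.update_of_ne hie] using hi
  have he : percMeasure G p {ω | ω e' ∈ ({true} : Set Bool)} ≠ 0 := by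
    have := (measurePreserving_eval_infinitePi
      (fun e => bernoulliMeasure true false (p e)) e').measure_preimage
      (measurableSet_singleton true).nullMeasurableSet
    refine fun h => ?_
    have h' : bernoulliMeasure true false (p e') {true} = 0 := this.symm.trans h
    rw [← measureReal_eq_zero_iff, bernoulliMeasure_real_apply _ (measurableSet_singleton _)] at h'
    have := hp e'
    simp at h'
    simp [h'] at this
  refine fun h => mul_ne_zero he hD (hmul.symm.trans (measure_mono_null ?_ h))
  rintro ω ⟨hω, hωD⟩
  have hω : ω e' = true := hω
  have hωD : Function.update ω e' true ∈ percolatesFrom G v := hωD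
  rw [← hω, Function.update_eq_self] at hωD
  exact percolatesFrom_of_openAdj ⟨e', hω, hl⟩ hωD

lemma percMeasure_percolatesFrom_ne_zero (hconn : Connected G) (hfin : LocallyFinite G)
    {p : G.edgeSet → I} (hp : ∀ e, 0 < p e)
    (hperc : ∀ᵐ c ∂(percMeasure G p), c ∈ percolates G) {x : V} (hx : x ∈ G.vertexSet) :
    percMeasure G p (percolatesFrom G x) ≠ 0 := by
  have hprob : IsProbabilityMeasure (percMeasure G p) := by unfold percMeasure; infer_instance
  obtain ⟨y, hy, hyperc⟩ :
      ∃ y ∈ G.vertexSet, percMeasure G p (percolatesFrom G y) ≠ 0 := by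
    by_contra! hcon
    have h0 : percMeasure G p (⋃ y ∈ G.vertexSet, percolatesFrom G y) = 0 :=
      (measure_biUnion_null_iff (countable_vertexSet hconn hfin)).2 hcon
    have h1 : ∀ᵐ c ∂(percMeasure G p), c ∉ ⋃ y ∈ G.vertexSet, percolatesFrom G y :=
      measure_eq_zero_iff_ae_notMem.1 h0
    obtain ⟨c, ⟨y, hy, hcy⟩, hc⟩ := (hperc.and h1).exists
    exact hc (Set.mem_biUnion hy hcy)
  have hpath := hconn.2 x hx y hy
  clear hx
  induction hpath using Relation.ReflTransGen.head_induction_on with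
  | refl => exact hyperc
  | head hxz _ ih => exact percMeasure_percolatesFrom_ne_zero_of_adj hconn hfin hp hxz ih

end Static

/-! ### Dynamical percolation -/

section Dynamic

variable {V E : Type*} {G : Graph V E} {p : G.edgeSet → I}
  {Ω : Type*} [MeasurableSpace Ω] {P : Measure Ω}
  {η : ℝ≥0 → Ω → Config G}

lemma RegularPath.isClosed {f : ℝ≥0 → Bool} (hf : RegularPath f) : IsClosed {t | f t = true} := by
  rw [← hf.2]
  exact isClosed_closure

/-- A regular path is on at time `t` exactly if there are on-times arbitrarily close to `t` in a
given countable dense set. -/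
lemma RegularPath.eq_true_iff {f : ℝ≥0 → Bool} (hf : RegularPath f) {d : ℕ → ℝ≥0}
    (hd : DenseRange d) (t : ℝ≥0) :
    f t = true ↔ ∀ n : ℕ, ∃ k, dist t (d k) < 1 / ((n : ℝ) + 1) ∧ f (d k) = true := by
  constructor
  · intro ht n
    have ht' : t ∈ closure (interior {t | f t = true}) := by rw [hf.2]; exact ht
    obtain ⟨s, hs, hst⟩ := mem_closure_iff.1 ht' (Metric.ball t (1 / ((n : ℝ) + 1)))
      Metric.isOpen_ball (Metric.mem_ball_self (by positivity))
    obtain ⟨k, hk⟩ := hd.exists_mem_open (Metric.isOpen_ball.inter isOpen_interior) ⟨s, hs, hst⟩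
    exact ⟨k, Metric.mem_ball'.1 hk.1, interior_subset (s := {t | f t = true}) hk.2⟩
  · intro h
    have : t ∈ closure {t | f t = true} := by
      refine Metric.mem_closure_iff.2 fun ε hε => ?_
      obtain ⟨n, hn⟩ := exists_nat_one_div_lt hε
      obtain ⟨k, hk, hfk⟩ := h n
      exact ⟨d k, hfk, hk.trans hn⟩
    rwa [hf.isClosed.closure_eq] at this

namespace IsDynamicalPercolation

lemma measurable_config (hη : IsDynamicalPercolation G p P η) (t : ℝ≥0) : Measurable (η t) :=
  measurable_pi_lambda _ fun e => (hη.chain e).1 t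

lemma measurable_path (hη : IsDynamicalPercolation G p P η) (e : G.edgeSet) :
    Measurable fun ω t => η t ω e :=
  measurable_pi_lambda _ fun t => (hη.chain e).1 t

lemma map_eq_percMeasure [IsProbabilityMeasure P] (hη : IsDynamicalPercolation G p P η) (t : ℝ≥0) :
    P.map (η t) = percMeasure G p := by
  have := (hη.indep.comp (fun _ f => f t) fun _ => measurable_pi_apply t).map_fun_eq_infinitePi_map
    fun e => (hη.chain e).1 t
  refine this.trans ?_
  unfold percMeasure
  congr 1
  ext1 e
  exact (hη.chain e).map_eq t

/-- The law of the process is invariant under time shifts. -/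
lemma map_shift_eq [IsProbabilityMeasure P] (hη : IsDynamicalPercolation G p P η) (s : ℝ≥0) :
    P.map (fun ω (e : G.edgeSet) (t : ℝ≥0) => η (s + t) ω e) =
      P.map (fun ω (e : G.edgeSet) (t : ℝ≥0) => η t ω e) := by
  have hshift : Measurable fun (f : ℝ≥0 → Bool) t => f (s + t) :=
    measurable_pi_lambda _ fun t => measurable_pi_apply _
  refine ((hη.indep.comp (fun _ f t => f (s + t)) fun _ => hshift).map_fun_eq_infinitePi_map
    fun e => hshift.comp (hη.measurable_path e)).trans ?_
  rw [hη.indep.map_fun_eq_infinitePi_map hη.measurable_path]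
  congr 1
  ext1 e
  exact (hη.chain e).map_shift_eq s

/-- The probability that `A` occurs at exactly one of two times is at most the distance of
these times, multiplied by the sum of the influences on `A`. -/
lemma measure_not_iff_le [IsProbabilityMeasure P] (hη : IsDynamicalPercolation G p P η)
    {A : Set (Config G)} (hA : MeasurableSet A) {s t : ℝ≥0} (hst : s ≤ t) :
    P {ω | ¬ (η s ω ∈ A ↔ η t ω ∈ A)} ≤
      ENNReal.ofReal ((t : ℝ) - s) * ∑' e, influence G p A e := by
  have hpair : iIndepFun (fun (e : G.edgeSet) ω => (η s ω e, η t ω e)) P :=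
    hη.indep.comp (fun _ f => (f s, f t)) fun _ =>
      (measurable_pi_apply s).prodMk (measurable_pi_apply t)
  refine (measure_not_mem_iff_mem_le (fun e => (hη.chain e).1 s) (fun e => (hη.chain e).1 t) hpair
    (fun e => (hη.chain e).map_eq s) (fun e => (hη.chain e).map_eq t) hA).trans ?_
  rw [← ENNReal.tsum_mul_left]
  refine ENNReal.tsum_le_tsum fun e => mul_le_mul' ((hη.chain e).measure_ne_le hst) (le_of_eq ?_)
  unfold influence IsPivotal flip percMeasure
  congr!

lemma ae_isClosed (hη : IsDynamicalPercolation G p P η) (hfin : LocallyFinite G) :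
    ∀ᵐ ω ∂P, ∀ x ∈ G.vertexSet, IsClosed {t | η t ω ∈ percolatesFrom G x} := by
  filter_upwards [hη.regular] with ω hω x hx
  exact isClosed_setOf_mem_percolatesFrom hfin hx fun e => (hω e).isClosed

/-- Up to a null set of paths, the event `{(t, ω) | A occurs at time t}` is jointly measurable. -/
lemma exists_measurableSet_prod (hη : IsDynamicalPercolation G p P η) (A : Set (Config G))
    (hA : MeasurableSet A) : ∃ B : Set (ℝ≥0 × Ω), MeasurableSet B ∧
      ∀ᵐ ω ∂P, ∀ t, (t, ω) ∈ B ↔ η t ω ∈ A := by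
  classical
  let d := TopologicalSpace.denseSeq ℝ≥0
  let S : G.edgeSet → Set (ℝ≥0 × Ω) := fun e =>
    {z | ∀ n : ℕ, ∃ k, dist z.1 (d k) < 1 / ((n : ℝ) + 1) ∧ η (d k) z.2 e = true}
  have hS : ∀ e, MeasurableSet (S e) := by
    intro e
    refine MeasurableSet.congr (s := ⋂ n : ℕ, ⋃ k,
      {z | dist z.1 (d k) < 1 / ((n : ℝ) + 1)} ∩ {z | η (d k) z.2 e = true}) ?_ (by ext; simp [S])
    refine MeasurableSet.iInter fun n => MeasurableSet.iUnion fun k => MeasurableSet.inter ?_ ?_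
    · exact measurableSet_lt (measurable_fst.dist measurable_const) measurable_const
    · exact ((hη.chain e).1 (d k)).comp measurable_snd (measurableSet_singleton true)
  let Z : ℝ≥0 × Ω → Config G := fun z e => decide (z ∈ S e)
  have hZ : Measurable Z := by
    refine measurable_pi_lambda _ fun e => measurable_to_bool ?_
    convert hS e using 1
    ext z
    simp [Z]
  refine ⟨Z ⁻¹' A, hZ hA, ?_⟩
  filter_upwards [hη.regular] with ω hω t
  have : Z (t, ω) = η t ω := by
    ext e
    have h1 := (hω e).eq_true_iff (TopologicalSpace.denseRange_denseSeq ℝ≥0) t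
    have h2 : Z (t, ω) e = true ↔ η t ω e = true := by
      rw [h1]
      simp only [Z, decide_eq_true_eq]
      rfl
    exact Bool.eq_iff_iff.2 h2
  rw [Set.mem_preimage, this]

end IsDynamicalPercolation

end Dynamic

/-! ### Bounded variation from summable influences -/

section Dynamic

open Filter Topology

variable {V E : Type*} {G : Graph V E} {p : G.edgeSet → I}
  {Ω : Type*} [MeasurableSpace Ω] {P : Measure Ω}
  {η : ℝ≥0 → Ω → Config G}

lemma percIndicator_eq_zero_or_one (x : V) (c : ℝ≥0 → Config G) (t : ℝ) :
    percIndicator G x c t = 0 ∨ percIndicator G x c t = 1 := by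
  unfold percIndicator
  split_ifs <;> simp

lemma percIndicator_eq_one_iff {x : V} {c : ℝ≥0 → Config G} {t : ℝ} :
    percIndicator G x c t = 1 ↔ c t.toNNReal ∈ percolatesFrom G x := by
  unfold percIndicator
  split_ifs with h <;> simp [h]

lemma percIndicator_eq_zero_iff {x : V} {c : ℝ≥0 → Config G} {t : ℝ} :
    percIndicator G x c t = 0 ↔ c t.toNNReal ∉ percolatesFrom G x := by
  unfold percIndicator
  split_ifs with h <;> simp [h]

namespace IsDynamicalPercolation

/-- Up to a null set of paths, the indicator of `x ↔ ∞` is jointly measurable. -/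
lemma exists_measurable_percIndicator (hη : IsDynamicalPercolation G p P η) (hconn : Connected G)
    (hfin : LocallyFinite G) {x : V} (hx : x ∈ G.vertexSet) :
    ∃ ψ : ℝ × Ω → ℝ, Measurable ψ ∧
      ∀ᵐ ω ∂P, ∀ t, ψ (t, ω) = percIndicator G x (fun s => η s ω) t := by
  classical
  obtain ⟨B, hB, hBη⟩ := hη.exists_measurableSet_prod _ (measurableSet_percolatesFrom hconn hfin hx)
  refine ⟨fun z => if (z.1.toNNReal, z.2) ∈ B then 1 else 0, Measurable.ite ?_ measurable_const
    measurable_const, ?_⟩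
  · exact (measurable_fst.real_toNNReal.prodMk measurable_snd) hB
  · filter_upwards [hBη] with ω hω t
    unfold percIndicator
    simp only [hω]

variable [IsProbabilityMeasure P]

/-- If the influences are summable, then the expected `L¹`-norms of the difference quotients of
`t ↦ 1_{x ↔ ∞ at time t}` are bounded by their sum, and by Fatou's lemma almost every path of this
process is of bounded variation up to a null set of times. -/
lemma ae_aeEqBoundedVariation (hη : IsDynamicalPercolation G p P η) (hconn : Connected G)
    (hfin : LocallyFinite G) {x : V} (hx : x ∈ G.vertexSet)
    (hsum : (∑' e, influence G p (percolatesFrom G x) e) ≠ ⊤) :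
    ∀ᵐ ω ∂P, AEEqBoundedVariation (percIndicator G x (fun t => η t ω)) := by
  set C := ∑' e, influence G p (percolatesFrom G x) e with hC
  obtain ⟨ψ, hψ, hψη⟩ := hη.exists_measurable_percIndicator hconn hfin hx
  have hAm := measurableSet_percolatesFrom hconn hfin hx
  let h : ℕ → ℝ := fun n => 1 / ((n : ℝ) + 1)
  have hpos : ∀ n, 0 < h n := fun n => by positivity
  have hmeas : ∀ n, Measurable fun z : Ω × ℝ => ‖ψ (z.2 + h n, z.1) - ψ (z.2, z.1)‖ₑ := by
    intro n
    exact ((hψ.comp ((measurable_snd.add_const _).prodMk measurable_fst)).sub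
      (hψ.comp (measurable_snd.prodMk measurable_fst))).enorm
  let Q : ℕ → Ω → ℝ≥0∞ := fun n ω => ENNReal.ofReal (h n)⁻¹ *
    ∫⁻ u in Set.Icc (0 : ℝ) 1, ‖ψ (u + h n, ω) - ψ (u, ω)‖ₑ
  have hQm : ∀ n, Measurable (Q n) := fun n => ((hmeas n).lintegral_prod_right').const_mul _
  have hQ : ∀ n, ∫⁻ ω, Q n ω ∂P ≤ C := by
    intro n
    have hu : ∀ u ∈ Set.Icc (0 : ℝ) 1,
        ∫⁻ ω, ‖ψ (u + h n, ω) - ψ (u, ω)‖ₑ ∂P ≤ ENNReal.ofReal (h n) * C := by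
      intro u hu
      have hle : u.toNNReal ≤ (u + h n).toNNReal := Real.toNNReal_le_toNNReal (by linarith [hpos n])
      have hmn := hη.measure_not_iff_le hAm hle
      rw [Real.coe_toNNReal _ hu.1, Real.coe_toNNReal _ (by linarith [hpos n, hu.1]),
        add_sub_cancel_left] at hmn
      refine le_trans ?_ hmn
      refine le_trans (lintegral_mono_ae ?_) (lintegral_indicator_one_le _)
      filter_upwards [hψη] with ω hω
      rw [hω, hω]
      by_cases h1 : η u.toNNReal ω ∈ percolatesFrom G x <;>
        by_cases h2 : η (u + h n).toNNReal ω ∈ percolatesFrom G x <;>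
          simp [percIndicator, h1, h2, Set.indicator]
    rw [lintegral_const_mul _ (hmeas n).lintegral_prod_right',
      lintegral_lintegral_swap (hmeas n).aemeasurable]
    calc _ ≤ ENNReal.ofReal (h n)⁻¹ * ∫⁻ u in Set.Icc (0 : ℝ) 1, ENNReal.ofReal (h n) * C := by
          gcongr ENNReal.ofReal (h n)⁻¹ * ?_
          exact setLIntegral_mono' measurableSet_Icc hu
      _ = C := by
          rw [setLIntegral_const, Real.volume_Icc, sub_zero, ENNReal.ofReal_one, mul_one,
            ← mul_assoc, ← ENNReal.ofReal_mul (by positivity), inv_mul_cancel₀ (hpos n).ne',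
            ENNReal.ofReal_one, one_mul]
  have hfatou : ∫⁻ ω, liminf (fun n => Q n ω) atTop ∂P ≠ ⊤ := by
    refine ne_top_of_le_ne_top hsum ((lintegral_liminf_le hQm).trans ?_)
    exact (liminf_le_liminf (Eventually.of_forall hQ)).trans_eq (liminf_const C)
  filter_upwards [ae_lt_top (Measurable.liminf hQm) hfatou, hψη] with ω hω hωψ
  obtain ⟨M, hM, hM'⟩ := exists_between hω
  have hfun : percIndicator G x (fun t => η t ω) = fun t => ψ (t, ω) := funext fun t => (hωψ t).symm
  have hloc : LocallyIntegrable (percIndicator G x (fun t => η t ω)) volume := by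
    refine (locallyIntegrable_const (1 : ℝ)).mono ?_ (Eventually.of_forall fun t => ?_)
    · rw [hfun]
      exact (hψ.comp measurable_prodMk_right).aestronglyMeasurable
    · rcases percIndicator_eq_zero_or_one x (fun t => η t ω) t with h | h <;> simp [h]
  refine aeEqBoundedVariation_of_frequently hloc hM'.ne hpos tendsto_one_div_add_atTop_nhds_zero_nat
    ((frequently_lt_of_liminf_lt (by isBoundedDefault) hM).mono fun n hn => ?_)
  simp only [hfun]
  exact hn.le

end IsDynamicalPercolation

/-! ### Absence of exceptional times -/

/-- The event that during the time interval `[0, L)` the vertices of some fixed finite set are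
enough to witness an infinite cluster. Restricting to the times in a countable dense set makes this
event measurable; it is expressed in terms of the paths of the edges. -/
def witnessedUntil (G : Graph V E) (L : ℝ≥0) : Set (G.edgeSet → ℝ≥0 → Bool) :=
  {y | ∃ K : Finset G.vertexSet, ∀ k, TopologicalSpace.denseSeq ℝ≥0 k < L →
    ∃ x ∈ K, (fun e => y e (TopologicalSpace.denseSeq ℝ≥0 k)) ∈ percolatesFrom G x}

lemma measurableSet_witnessedUntil (hconn : Connected G) (hfin : LocallyFinite G) (L : ℝ≥0) :
    MeasurableSet (witnessedUntil G L) := by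
  have := (countable_vertexSet hconn hfin).to_subtype
  have heq : witnessedUntil G L = ⋃ K : Finset G.vertexSet, ⋂ k,
      ⋂ (_ : TopologicalSpace.denseSeq ℝ≥0 k < L), ⋃ x ∈ K,
        (fun (y : G.edgeSet → ℝ≥0 → Bool) e => y e (TopologicalSpace.denseSeq ℝ≥0 k)) ⁻¹'
          percolatesFrom G x := by
    ext y; simp [witnessedUntil]
  rw [heq]
  refine MeasurableSet.iUnion fun K => MeasurableSet.iInter fun k => MeasurableSet.iInter fun _ =>
    Finset.measurableSet_biUnion _ fun x _ => ?_
  refine Measurable.comp (g := id) measurable_id (measurable_pi_lambda _ fun e => ?_)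
    (measurableSet_percolatesFrom hconn hfin x.2)
  exact (measurable_pi_apply _).comp (measurable_pi_apply e)

/-- Being witnessed by a finite set is a tail event: changing finitely many edges only requires
adding their ends to the finite set. -/
lemma dependsOn_witnessedUntil (L : ℝ≥0) (F : Finset G.edgeSet) :
    DependsOn (· ∈ witnessedUntil G L) (F : Set G.edgeSet)ᶜ := by
  have key : ∀ y y' : G.edgeSet → ℝ≥0 → Bool, (∀ e ∉ F, y e = y' e) → y ∈ witnessedUntil G L →
      y' ∈ witnessedUntil G L := by
    rintro y y' h ⟨K, hK⟩
    obtain ⟨K', hK'⟩ := exists_finset_forall_percolatesFrom_of_eq_off K F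
    exact ⟨K', fun k hk => hK' _ _ (fun e he => by rw [h e he]) (hK k hk)⟩
  exact fun y y' h => propext ⟨key y y' fun e he => h e (by simpa using he),
    key y' y fun e he => (h e (by simpa using he)).symm⟩

/-- On a regular path, a finite set of witnesses at a dense set of times is a set of witnesses
at all times. -/
lemma mem_percolates_of_witnessedUntil {c : ℝ≥0 → Config G}
    (hc : ∀ x ∈ G.vertexSet, IsClosed {t | c t ∈ percolatesFrom G x}) {s L : ℝ≥0}
    (h : (fun e t => c (s + t) e) ∈ witnessedUntil G L) {t : ℝ≥0} (ht : t < L) :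
    c (s + t) ∈ percolates G := by
  obtain ⟨K, hK⟩ := h
  have hclosed : IsClosed (⋃ x ∈ K, {r | c (s + r) ∈ percolatesFrom G (x : V)}) :=
    K.finite_toSet.isClosed_biUnion fun x _ => (hc x x.2).preimage (continuous_const_add s)
  have hsub : Set.Iio L ∩ Set.range (TopologicalSpace.denseSeq ℝ≥0) ⊆
      ⋃ x ∈ K, {r | c (s + r) ∈ percolatesFrom G (x : V)} := by
    rintro _ ⟨hr, k, rfl⟩
    obtain ⟨x, hx, hperc⟩ := hK k hr
    exact Set.mem_biUnion hx hperc
  have hmem := hclosed.closure_subset_iff.2 hsub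
    ((TopologicalSpace.denseRange_denseSeq ℝ≥0).open_subset_closure_inter isOpen_Iio ht)
  obtain ⟨x, -, hx⟩ := Set.mem_iUnion₂.1 hmem
  exact ⟨x, x.2, hx⟩

/-- If `x` percolates at almost every time in an interval, then by closedness it does so at every
time in it. -/
lemma witnessedUntil_of_ae_eq_one {c : ℝ≥0 → Config G} {x : V} (hx : x ∈ G.vertexSet)
    (hc : IsClosed {t | c t ∈ percolatesFrom G x}) {a b : ℝ≥0} (hab : a < b)
    (h : ∀ᵐ t ∂(volume.restrict (Set.Ioo (a : ℝ) b)), percIndicator G x c t = 1) :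
    (fun e t => c (a + t) e) ∈ witnessedUntil G (b - a) := by
  let T : Set ℝ := {t | c t.toNNReal ∈ percolatesFrom G x}
  have hT : IsClosed T := hc.preimage continuous_real_toNNReal
  have hIoo : Set.Ioo (a : ℝ) b ⊆ T := by
    rw [ae_restrict_iff' measurableSet_Ioo] at h
    have hnull : volume (Set.Ioo (a : ℝ) b ∩ Tᶜ) = 0 := by
      refine measure_mono_null (fun t ht => ?_) (ae_iff.1 h)
      exact fun h' => ht.2 (percIndicator_eq_one_iff.1 (h' ht.1))
    have hempty := ((isOpen_Ioo.inter hT.isOpen_compl).measure_eq_zero_iff volume).1 hnull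
    intro t ht
    by_contra htT
    exact (Set.mem_empty_iff_false t).1 (hempty ▸ ⟨ht, htT⟩)
  have hIcc : Set.Icc (a : ℝ) b ⊆ T := by
    rw [← closure_Ioo (by exact_mod_cast hab.ne)]
    exact hT.closure_subset_iff.2 hIoo
  refine ⟨{⟨x, hx⟩}, fun k hk => ⟨_, Finset.mem_singleton_self _, ?_⟩⟩
  have hmem : ((a + TopologicalSpace.denseSeq ℝ≥0 k : ℝ≥0) : ℝ) ∈ T := by
    refine hIcc ⟨?_, ?_⟩
    · exact_mod_cast le_self_add
    · exact_mod_cast (lt_tsub_iff_left.1 hk).le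
  simpa only [T, Set.mem_ofPred_eq, Real.toNNReal_coe] using hmem

namespace IsDynamicalPercolation

variable [IsProbabilityMeasure P]

lemma measure_shift_witnessedUntil_eq (hη : IsDynamicalPercolation G p P η) (hconn : Connected G)
    (hfin : LocallyFinite G) (L s : ℝ≥0) :
    P {ω | (fun e t => η (s + t) ω e) ∈ witnessedUntil G L} =
      P {ω | (fun e t => η t ω e) ∈ witnessedUntil G L} := by
  have hD := measurableSet_witnessedUntil hconn hfin L (G := G)
  have h := congrArg (fun μ => μ (witnessedUntil G L)) (hη.map_shift_eq s)
  rwa [Measure.map_apply (measurable_pi_lambda _ fun e => measurable_pi_lambda _ fun t =>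
      (hη.chain e).1 _) hD,
    Measure.map_apply (measurable_pi_lambda _ hη.measurable_path) hD] at h

/-- By the 0-1 law and stationarity, a positive probability of having a finite set of witnesses
during some time interval excludes exceptional times altogether. -/
lemma ae_forall_mem_percolates (hη : IsDynamicalPercolation G p P η) (hconn : Connected G)
    (hfin : LocallyFinite G) {L : ℝ≥0} (hL : 0 < L)
    (hpos : P {ω | (fun e t => η t ω e) ∈ witnessedUntil G L} ≠ 0) :
    ∀ᵐ ω ∂P, ∀ t, η t ω ∈ percolates G := by
  have hD := measurableSet_witnessedUntil hconn hfin L (G := G)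
  have hone := (measure_eq_zero_or_one_of_dependsOn_compl_finset hη.measurable_path hη.indep hD
    (dependsOn_witnessedUntil L)).resolve_left hpos
  have hshift : ∀ᵐ ω ∂P, ∀ n : ℕ, (fun e t => η (n * L + t) ω e) ∈ witnessedUntil G L := by
    refine ae_all_iff.2 fun n => ?_
    have hmeas : Measurable fun ω (e : G.edgeSet) (t : ℝ≥0) => η (n * L + t) ω e :=
      measurable_pi_lambda _ fun e => measurable_pi_lambda _ fun t => (hη.chain e).1 _
    exact (mem_ae_iff_prob_eq_one (hmeas hD)).2
      ((hη.measure_shift_witnessedUntil_eq hconn hfin L _).trans hone)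
  filter_upwards [hshift, hη.ae_isClosed hfin] with ω hω hclosed t
  have hfloor : (⌊t / L⌋₊ : ℝ≥0) * L ≤ t := by
    calc (⌊t / L⌋₊ : ℝ≥0) * L ≤ t / L * L := by
          gcongr
          exact Nat.floor_le zero_le
      _ = t := div_mul_cancel₀ t hL.ne'
  have hlt : t - (⌊t / L⌋₊ : ℝ≥0) * L < L := by
    refine (tsub_lt_iff_left hfloor).2 ?_
    calc t = t / L * L := (div_mul_cancel₀ t hL.ne').symm
      _ < (⌊t / L⌋₊ + 1) * L := by
          gcongr
          exact Nat.lt_floor_add_one _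
      _ = (⌊t / L⌋₊ : ℝ≥0) * L + L := by ring
  have := mem_percolates_of_witnessedUntil (c := fun s => η s ω) hclosed (hω ⌊t / L⌋₊) hlt
  simpa only [add_tsub_cancel_of_le hfloor] using this

/-- If `x` percolates with positive probability at a fixed time, then with positive probability it
percolates during a set of times in `[0, 1]` of positive measure. -/
lemma not_ae_ae_percIndicator_eq_zero (hη : IsDynamicalPercolation G p P η) (hconn : Connected G)
    (hfin : LocallyFinite G) {x : V} (hx : x ∈ G.vertexSet)
    (hpos : percMeasure G p (percolatesFrom G x) ≠ 0) :
    ¬ ∀ᵐ ω ∂P, ∀ᵐ t ∂(volume.restrict (Set.Icc (0 : ℝ) 1)),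
      percIndicator G x (fun s => η s ω) t = 0 := by
  intro h
  obtain ⟨ψ, hψ, hψη⟩ := hη.exists_measurable_percIndicator hconn hfin hx
  have h1 : ∀ᵐ ω ∂P, ∀ᵐ t ∂(volume.restrict (Set.Icc (0 : ℝ) 1)), ψ (t, ω) = 0 := by
    filter_upwards [h, hψη] with ω hω hω'
    filter_upwards [hω] with t ht
    rw [hω', ht]
  have hmeas : MeasurableSet {z : Ω × ℝ | ψ (z.2, z.1) = 0} :=
    (hψ.comp (measurable_snd.prodMk measurable_fst)) (measurableSet_singleton 0)
  have h2 := (Measure.ae_ae_comm (p := fun ω t => ψ (t, ω) = 0) hmeas).1 h1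
  have : (ae (volume.restrict (Set.Icc (0 : ℝ) 1))).NeBot := by
    rw [ae_restrict_neBot]; simp
  obtain ⟨t, ht⟩ := h2.exists
  refine hpos ?_
  rw [← hη.map_eq_percMeasure t.toNNReal, Measure.map_apply (hη.measurable_config _)
    (measurableSet_percolatesFrom hconn hfin hx), measure_eq_zero_iff_ae_notMem]
  filter_upwards [ht, hψη] with ω hω hω'
  exact percIndicator_eq_zero_iff.1 ((hω' t).symm.trans hω)

lemma ae_forall_mem_percolates_of_aeEqBoundedVariation (hη : IsDynamicalPercolation G p P η)
    (hconn : Connected G) (hfin : LocallyFinite G) {x : V} (hx : x ∈ G.vertexSet)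
    (hpos : percMeasure G p (percolatesFrom G x) ≠ 0)
    (hBV : ∀ᵐ ω ∂P, AEEqBoundedVariation (percIndicator G x (fun t => η t ω))) :
    ∀ᵐ ω ∂P, ∀ t, η t ω ∈ percolates G := by
  by_contra hexc
  have hnull : ∀ᵐ ω ∂P, ∀ a b : ℚ, 0 ≤ a → a < b →
      (fun e t => η ((a : ℝ).toNNReal + t) ω e) ∉
        witnessedUntil G ((b : ℝ).toNNReal - (a : ℝ).toNNReal) := by
    refine ae_all_iff.2 fun a => ae_all_iff.2 fun b => ?_
    refine eventually_imp_distrib_left.2 fun ha => eventually_imp_distrib_left.2 fun hab => ?_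
    refine measure_eq_zero_iff_ae_notMem.1 ?_
    by_contra hne
    refine hexc (hη.ae_forall_mem_percolates hconn hfin (tsub_pos_of_lt ?_)
      (hη.measure_shift_witnessedUntil_eq hconn hfin _ _ ▸ hne))
    exact (Real.toNNReal_lt_toNNReal_iff (by exact_mod_cast ha.trans_lt hab)).2
      (by exact_mod_cast hab)
  refine hη.not_ae_ae_percIndicator_eq_zero hconn hfin hx hpos ?_
  filter_upwards [hBV, hnull, hη.ae_isClosed hfin] with ω hω hωnull hclosed
  by_contra hne
  obtain ⟨a, b, ha, hab, hone⟩ :=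
    hω.exists_interval (percIndicator_eq_zero_or_one x fun t => η t ω) hne
  have ha' : (0 : ℝ) ≤ a := by exact_mod_cast ha
  have hab' : (a : ℝ) < b := by exact_mod_cast hab
  refine hωnull a b ha hab (witnessedUntil_of_ae_eq_one (c := fun s => η s ω) hx (hclosed x hx)
    ((Real.toNNReal_lt_toNNReal_iff (ha'.trans_lt hab')).2 hab') ?_)
  rwa [Real.coe_toNNReal _ ha', Real.coe_toNNReal _ (ha'.trans hab'.le)]

end IsDynamicalPercolation

end Dynamic

end DynPerc

theorem theorem1p4 {V : Type*} {E : Type*} (G : Graph V E)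
    (hconn : DynPerc.Connected G) (hfin : DynPerc.LocallyFinite G)
    (p : G.edgeSet → unitInterval) (hp : ∀ e, 0 < p e)
    (hperc : ∀ᵐ c ∂(DynPerc.percMeasure G p), c ∈ DynPerc.percolates G)
    (x : V) (hx : x ∈ G.vertexSet)
    {Ω : Type*} [MeasurableSpace Ω] (P : MeasureTheory.Measure Ω)
    [MeasureTheory.IsProbabilityMeasure P]
    (η : NNReal → Ω → DynPerc.Config G) (hη : DynPerc.IsDynamicalPercolation G p P η) :
    ((∑' e, DynPerc.influence G p (DynPerc.percolatesFrom G x) e) ≠ ⊤ →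
      (∀ᵐ ω ∂P, DynPerc.AEEqBoundedVariation
        (DynPerc.percIndicator G x (fun t => η t ω))) ∧
      (∀ᵐ ω ∂P, ∀ t, η t ω ∈ DynPerc.percolates G)) ∧
    ((∀ᵐ ω ∂P, DynPerc.AEEqBoundedVariation
        (DynPerc.percIndicator G x (fun t => η t ω))) →
      (∀ᵐ ω ∂P, ∀ t, η t ω ∈ DynPerc.percolates G)) := by
  have hpos := DynPerc.percMeasure_percolatesFrom_ne_zero hconn hfin hp hperc hx
  have hsecond := hη.ae_forall_mem_percolates_of_aeEqBoundedVariation hconn hfin hx hpos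
  refine ⟨fun hsum => ?_, hsecond⟩
  have hBV := hη.ae_aeEqBoundedVariation hconn hfin hx hsum
  exact ⟨hBV, hsecond hBV⟩
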